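/- **Model.** A network is a directed graph (parallel edges allowed) with finitely many edges, a source $s$ and a sink $t\neq s$, where each edge $e$ has a transit time $\tau_e\ge 0$, a capacity $\nu_e>0$ and a cost $c_e\ge 0$; moreover there are a constant inflow rate $u>0$ and a deadline $D$. Let $\mathcal P$ be the set of (simple) $s,t$-paths and $c_P=\sum_{e\in P}c_e$. The network is a *parallel path network* if its $s,t$-paths are pairwise edge disjoint. A *flow over time* consists of nonnegative measurable path inflow rates $(f_P^+)_{P\in\mathcal P}$ with $\sum_{P} f_P^+(\theta)=u$ for all $\theta\ge 0$, where particle $\theta$ is the flow leaving $s$ at time $\theta$, together with the edge inflow rates $f_e^+$ and queue masses $z_e$ that they induce: $z_e(0)=0$ and, for almost every $\theta$, $z_e'(\theta)=f_e^+(\theta)-\nu_e$ if $z_e(\theta)>0$ and $z_e'(\theta)=\max\{f_e^+(\theta)-\nu_e,0\}$ if $z_e(\theta)=0$; a particle entering $e$ at time $\theta$ leaves it at time $T_e(\theta)=\theta+z_e(\theta)/\nu_e+\tau_e$; particle $\theta$ using $P$ reaches the nodes of $P$ at the times $\ell^P_s(\theta)=\theta$, $\ell^P_w(\theta)=T_{vw}(\ell^P_v(\theta))$;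 and the amount of flow that has entered $e=(v,w)$ by time $\theta$ is the amount of flow, over all paths $P\ni e$, of the particles $\xi\ge 0$ with $\ell^P_v(\xi)\le\theta$. At every node other than $t$ the edge rates obey flow conservation: outgoing inflow rates minus incoming outflow rates equal $u$ at $s$ and $0$ elsewhere, where the outflow rate of $e$ at time $\theta+\tau_e$ is $\nu_e$ if $z_e(\theta)>0$ and $\min\{f_e^+(\theta),\nu_e\}$ otherwise. The cost of particle $\theta$ along $P$ is $c_P(\theta)=c_P$ if $\ell^P_t(\theta)<D$ and $c_P(\theta)=\infty$ otherwise. The flow $f$ is a *Nash flow* if for all $\theta\ge0$ and all $P$, $f_P^+(\theta)>0$ implies $c_P(\theta)=\min_{Q\in\mathcal P}c_Q(\theta)$. The throughput $M_f$ is the amount of flow that arrives at $t$ before $D$, i.e. $M_f=\sum_P\int_{\{\theta\ge0:\,\ell^P_t(\theta)<D\}}f_P^+(\theta)\,d\theta$. With $M^*=\sup_f M_f$ over all flows over time, the *throughput-price of anarchy* of the network is $t\text{-}PoA=\sup\{M^*/M_f : f\text{ a Nash flow}\}$ (where $0/0:=0$ and $x/0:=\infty$ for $x>0$). **Theorem.**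 In every parallel path network, with arbitrary transit times, $t\text{-}PoA\le 2$. This bound is tight: for every $\varepsilon\in(0,1)$, the network consisting of two parallel links from $s$ to $t$ with $u=D=1$, the cheaper link having $\tau=0$, $\nu=\varepsilon$ and the more expensive one $\tau=1-\varepsilon$, $\nu=1-\varepsilon$, is a parallel path network with $t\text{-}PoA\ge 2-\varepsilon$. -/

import Mathlib

open MeasureTheory
open scoped ENNReal

/-- A (finite, directed, multi-)network: edges `E` with tail `src` and head `tgt`, source `s`,
sink `t`, transit times, capacities and costs of the edges, constant inflow rate `u` at the source
and deadline `D`. -/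
structure FlowNetwork (V : Type*) (E : Type*) where
  src : E → V
  tgt : E → V
  s : V
  t : V
  s_ne_t : s ≠ t
  transit : E → ℝ
  transit_nonneg : ∀ e, 0 ≤ transit e
  capacity : E → ℝ
  capacity_pos : ∀ e, 0 < capacity e
  cost : E → ℝ
  cost_nonneg : ∀ e, 0 ≤ cost e
  u : ℝ
  u_pos : 0 < u
  D : ℝ

namespace FlowNetwork

variable {V : Type*} {E : Type*}

/-- `N.IsWalk v p w`: the list of edges `p` is a directed walk from `v` to `w`. -/
def IsWalk (N : FlowNetwork V E) : V → List E → V → Prop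
  | v, [], w => v = w
  | v, e :: p, w => N.src e = v ∧ N.IsWalk (N.tgt e) p w

/-- `p` is the edge list of an `s`,`t`-path, i.e. of a walk from `s` to `t` that visits no vertex
twice. -/
def IsPath (N : FlowNetwork V E) (p : List E) : Prop :=
  N.IsWalk N.s p N.t ∧ (N.s :: p.map N.tgt).Nodup

/-- The set `𝒫` of all `s`,`t`-paths. -/
def Path (N : FlowNetwork V E) : Type _ := {p : List E // N.IsPath p}

/-- The edges of a path, in the order in which they are traversed. -/
def Path.edges {N : FlowNetwork V E} (P : N.Path) : List E := P.1

instance (N : FlowNetwork V E) [Finite E] : Finite N.Path := by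
  classical
  have := Fintype.ofFinite E
  refine Finite.of_injective
    (fun P : N.Path => (⟨P.1, (List.nodup_cons.1 P.2.2).2.of_map⟩ : {l : List E // l.Nodup})) ?_
  intro P Q h
  exact Subtype.ext (congrArg (fun l : {l : List E // l.Nodup} => l.1) h)

noncomputable instance (N : FlowNetwork V E) [Finite E] : Fintype N.Path := Fintype.ofFinite _

/-- A parallel path network: all `s`,`t`-paths are (pairwise) edge disjoint. -/
def IsParallelPath (N : FlowNetwork V E) : Prop :=
  ∀ P Q : N.Path, P ≠ Q → List.Disjoint P.edges Q.edges

/-- The cost `c_P` of a path. -/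
def pathCost (N : FlowNetwork V E) (P : N.Path) : ℝ := (P.edges.map N.cost).sum

/-- `T_e(θ) = θ + z_e(θ) / ν_e + τ_e`: the time at which a particle that enters `e` at time `θ`
leaves `e`, for queue masses `z`. -/
noncomputable def exitTime (N : FlowNetwork V E) (z : E → ℝ → ℝ) (e : E) (θ : ℝ) : ℝ :=
  θ + z e θ / N.capacity e + N.transit e

open Classical in
/-- `ℓ^P_v(θ)`: the time at which particle `θ` arrives at the node `v` of `P` using the path `P`.
The exit times of the edges of `P` that precede `v` are composed, starting from `ℓ^P_s(θ) = θ`. -/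
noncomputable def arrivalTime (N : FlowNetwork V E) (z : E → ℝ → ℝ) (P : N.Path) (v : V)
    (θ : ℝ) : ℝ :=
  (P.edges.takeWhile (fun e => N.src e ≠ v)).foldl (fun x e => N.exitTime z e x) θ

open Classical in
/-- The outflow rate `f_e^-`: it is `ν_e` at time `θ + τ_e` if there is a queue at time `θ ≥ 0`,
and `min (f_e^+ θ) ν_e` otherwise; nothing leaves `e` before time `τ_e`. -/
noncomputable def outflowRate (N : FlowNetwork V E) (f : E → ℝ → ℝ) (z : E → ℝ → ℝ) (e : E)
    (θ : ℝ) : ℝ :=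
  if θ < N.transit e then 0
  else if 0 < z e (θ - N.transit e) then N.capacity e
  else min (f e (θ - N.transit e)) (N.capacity e)

open Classical in
/-- A flow over time, given by its path inflow rates `f_P^+` together with the edge inflow rates
`f_e^+` and queue masses `z_e` that they induce. Only times `θ ≥ 0` are relevant. Edge inflow rates
are understood up to null sets, as usual. -/
structure FlowOverTime (N : FlowNetwork V E) [Fintype E] where
  pathInflow : N.Path → ℝ → ℝ
  edgeInflow : E → ℝ → ℝ
  queue : E → ℝ → ℝ
  pathInflow_measurable : ∀ P, Measurable (pathInflow P)
  pathInflow_nonneg : ∀ P θ, 0 ≤ θ → 0 ≤ pathInflow P θ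
  edgeInflow_nonneg : ∀ e θ, 0 ≤ θ → 0 ≤ edgeInflow e θ
  edgeInflow_integrable : ∀ e θ, 0 ≤ θ → IntervalIntegrable (edgeInflow e) volume 0 θ
  /-- Particles leave the source at the constant total rate `u`. -/
  sum_pathInflow : ∀ θ, 0 ≤ θ → ∑ P, pathInflow P θ = N.u
  queue_continuous : ∀ e, ContinuousOn (queue e) (Set.Ici 0)
  /-- The queue dynamics `z_e' = f_e^+ - ν_e` if `z_e > 0` and `z_e' = max (f_e^+ - ν_e) 0` if
  `z_e = 0`, with `z_e(0) = 0`, in integrated form. In particular `z_e` never becomes negative. -/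
  queue_eq : ∀ e θ, 0 ≤ θ → queue e θ =
    ∫ ξ in (0 : ℝ)..θ, if 0 < queue e ξ then edgeInflow e ξ - N.capacity e
      else max (edgeInflow e ξ - N.capacity e) 0
  /-- The path inflow rates induce the edge inflow rates: the flow that has entered `e` up to time
  `θ` is the flow of the particles on paths through `e` that reach the tail of `e` up to time
  `θ`. -/
  edgeInflow_eq : ∀ e θ, 0 ≤ θ → ∫ ξ in (0 : ℝ)..θ, edgeInflow e ξ =
    ∑ P : N.Path, if e ∈ P.edges then
      ∫ ξ in {ξ : ℝ | 0 ≤ ξ ∧ N.arrivalTime queue P (N.src e) ξ ≤ θ}, pathInflow P ξ else 0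
  /-- Flow conservation at all nodes except the sink. -/
  conservation : ∀ v, v ≠ N.t → ∀ᵐ θ : ℝ, 0 ≤ θ →
    (∑ e, if N.src e = v then edgeInflow e θ else 0)
      - (∑ e, if N.tgt e = v then N.outflowRate edgeInflow queue e θ else 0)
      = if v = N.s then N.u else 0

namespace FlowOverTime

variable [Fintype E] {N : FlowNetwork V E}

/-- The time `ℓ^P_t(θ)` at which particle `θ` reaches the sink along `P`. -/
noncomputable def sinkTime (f : N.FlowOverTime) (P : N.Path) (θ : ℝ) : ℝ :=
  N.arrivalTime f.queue P N.t θ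

open Classical in
/-- The cost `c_P(θ)` of particle `θ` along `P`: it is `c_P` if the particle reaches the sink before
the deadline, and infinite otherwise. -/
noncomputable def particleCost (f : N.FlowOverTime) (P : N.Path) (θ : ℝ) : EReal :=
  if f.sinkTime P θ < N.D then (N.pathCost P : EReal) else ⊤

/-- Nash flows over time: every path with positive inflow at time `θ` minimizes the cost of
particle `θ`. -/
def IsNash (f : N.FlowOverTime) : Prop :=
  ∀ θ, 0 ≤ θ → ∀ P, 0 < f.pathInflow P θ → ∀ Q, f.particleCost P θ ≤ f.particleCost Q θ

/-- `M_f`: the amount of flow that arrives at the sink before the deadline. -/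
noncomputable def throughput (f : N.FlowOverTime) : ℝ :=
  ∑ P, ∫ θ in {θ : ℝ | 0 ≤ θ ∧ f.sinkTime P θ < N.D}, f.pathInflow P θ

end FlowOverTime

/-- `M^*`: the maximum throughput over all flows over time. -/
noncomputable def maxThroughput (N : FlowNetwork V E) [Fintype E] : ℝ≥0∞ :=
  ⨆ f : N.FlowOverTime, ENNReal.ofReal f.throughput

/-- The throughput-price of anarchy: the supremum of `M^* / M_f` over all Nash flows `f`, with
`0 / 0 = 0` (no flow at all can arrive before the deadline) and `x / 0 = ∞` for `x > 0`. -/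
noncomputable def throughputPoA (N : FlowNetwork V E) [Fintype E] : ℝ≥0∞ :=
  ⨆ (f : N.FlowOverTime) (_ : f.IsNash), N.maxThroughput / ENNReal.ofReal f.throughput

/-- Two parallel links from `0` to `1`, inflow rate and deadline `1`; the cheaper link has transit
time `0` and capacity `ε`, the more expensive one has transit time and capacity `1 - ε`. -/
noncomputable def twoLink (ε : ℝ) (h0 : 0 < ε) (h1 : ε < 1) : FlowNetwork (Fin 2) (Fin 2) where
  src := fun _ => 0
  tgt := fun _ => 1
  s := 0
  t := 1
  s_ne_t := by decide
  transit := ![0, 1 - ε]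
  transit_nonneg := by
    intro e
    fin_cases e
    · simp
    · simpa using h1.le
  capacity := ![ε, 1 - ε]
  capacity_pos := by
    intro e
    fin_cases e
    · simpa using h0
    · simpa using h1
  cost := ![0, 1]
  cost_nonneg := by
    intro e
    fin_cases e <;> simp
  u := 1
  u_pos := one_pos
  D := 1

end FlowNetwork

/-! Compare a Nash flow `f` with any flow `g`. On each path `P`, the particles of `f` in time are
those starting before some `m P`. Let `Q` maximize `m`. Between `m P` and `m Q` path `P` is late
while `Q` is not, so a Nash flow sends nothing into `P`. Hence the throughput of `f` is everything
that starts before `m Q`, namely `u * m Q`. The particles of `g` starting before `m Q` also amount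
to `u * m Q`. Those starting later on `P` and arriving in time must pass the bottleneck of `P`, of
capacity `ν`, so they amount to at most `ν * (D - τ_P - m Q)` (`pathVolume_sub_le`). In `f`,
particle `m P` reaches the sink no earlier than `D`; such a delay requires at least `ν * (D - τ_P -
m P)` of flow started on `P` (`mul_sub_le_pathVolume`), and `m P ≤ m Q`. Summing over the paths
bounds the late part of `g` by the throughput of `f` again. Both capacity bounds rest on
`edgeVolume_traversalTime`: with edge disjoint paths, flow keeps its order along each path. -/

namespace FlowNetwork

open Set

/-! ### Walks and arrival times as compositions of exit times -/

section Walks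

variable {V : Type*} {E : Type*} {N : FlowNetwork V E}

lemma IsWalk.src_mem {v w : V} {l₁ l₂ : List E} {e : E} (h : N.IsWalk v (l₁ ++ e :: l₂) w) :
    N.src e ∈ v :: l₁.map N.tgt := by
  induction l₁ generalizing v with
  | nil => simpa using h.1
  | cons a l ih => exact List.mem_cons_of_mem _ (ih h.2)

lemma IsWalk.target_mem {v w : V} {p : List E} (h : N.IsWalk v p w) :
    w ∈ v :: p.map N.tgt := by
  induction p generalizing v with
  | nil => simpa using Eq.symm h
  | cons a l ih => exact List.mem_cons_of_mem _ (ih h.2)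

lemma IsWalk.of_append {v w : V} {l₁ l₂ : List E} (h : N.IsWalk v (l₁ ++ l₂) w) :
    ∃ x, N.IsWalk x l₂ w := by
  induction l₁ generalizing v with
  | nil => exact ⟨v, h⟩
  | cons a l ih => exact ih h.2

-- No vertex repeats on a path, so the truncation in `arrivalTime` stops exactly at the edge `e`.
open Classical in
lemma IsWalk.takeWhile_src_ne {v w : V} {l₁ l₂ : List E} {e : E}
    (h : N.IsWalk v (l₁ ++ e :: l₂) w) (hd : (v :: (l₁ ++ e :: l₂).map N.tgt).Nodup) :
    (l₁ ++ e :: l₂).takeWhile (fun a => N.src a ≠ N.src e) = l₁ := by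
  induction l₁ generalizing v with
  | nil => simp
  | cons a l ih =>
    have hne : N.src a ≠ N.src e := by
      intro hae
      have hm := IsWalk.src_mem h.2
      rw [← hae, h.1] at hm
      refine (List.nodup_cons.1 hd).1 ?_
      simp only [List.cons_append, List.map_cons, List.map_append, List.mem_cons,
        List.mem_append] at hm ⊢
      tauto
    rw [List.cons_append, List.takeWhile_cons_of_pos (by simpa using hne),
      ih h.2 (List.nodup_cons.1 hd).2]

lemma IsPath.src_ne_sink {p : List E} (h : N.IsPath p) {e : E} (he : e ∈ p) :
    N.src e ≠ N.t := by
  obtain ⟨l₁, l₂, rfl⟩ := List.append_of_mem he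
  intro het
  have h₁ := h.1.src_mem
  obtain ⟨x, hx⟩ := h.1.of_append
  have h₂ := IsWalk.target_mem hx.2
  have hd := h.2
  rw [List.map_append, ← List.cons_append] at hd
  exact (List.nodup_append'.1 hd).2.2 h₁ (by rw [het]; simpa using h₂)

lemma Path.edges_ne_nil (P : N.Path) : P.edges ≠ [] := by
  intro h
  have := P.2.1
  rw [show P.1 = [] from h] at this
  exact N.s_ne_t this

lemma exists_bottleneck (P : N.Path) :
    ∃ e ∈ P.edges, ∀ a ∈ P.edges, N.capacity e ≤ N.capacity a := by
  classical
  obtain ⟨e, he, hmin⟩ := P.edges.toFinset.exists_min_image N.capacity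
    (by simpa [List.toFinset_nonempty_iff] using P.edges_ne_nil)
  exact ⟨e, by simpa using he, by simpa using hmin⟩

/-- The time at which a particle that starts at time `θ` has traversed all the edges of `l`. -/
noncomputable def traversalTime (N : FlowNetwork V E) (z : E → ℝ → ℝ) (l : List E) (θ : ℝ) : ℝ :=
  l.foldl (fun x e => N.exitTime z e x) θ

@[simp]
lemma traversalTime_nil (z : E → ℝ → ℝ) (θ : ℝ) : N.traversalTime z [] θ = θ := rfl

lemma traversalTime_append (z : E → ℝ → ℝ) (l₁ l₂ : List E) (θ : ℝ) :
    N.traversalTime z (l₁ ++ l₂) θ = N.traversalTime z l₂ (N.traversalTime z l₁ θ) := by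
  simp [traversalTime]

lemma traversalTime_concat (z : E → ℝ → ℝ) (l : List E) (e : E) (θ : ℝ) :
    N.traversalTime z (l ++ [e]) θ = N.exitTime z e (N.traversalTime z l θ) := by
  simp [traversalTime]

lemma arrivalTime_src (z : E → ℝ → ℝ) (P : N.Path) {l₁ l₂ : List E} {e : E}
    (h : P.edges = l₁ ++ e :: l₂) (θ : ℝ) :
    N.arrivalTime z P (N.src e) θ = N.traversalTime z l₁ θ := by
  have hP : N.IsPath (l₁ ++ e :: l₂) := h ▸ P.2
  rw [arrivalTime, h, hP.1.takeWhile_src_ne hP.2, traversalTime]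

lemma arrivalTime_sink (z : E → ℝ → ℝ) (P : N.Path) (θ : ℝ) :
    N.arrivalTime z P N.t θ = N.traversalTime z P.edges θ := by
  rw [arrivalTime, List.takeWhile_eq_self_iff.2, traversalTime]
  intro e he
  simpa using P.2.src_ne_sink he

end Walks

/-- Sublevel sets on `[0, ∞)` of a continuous monotone function that dominates the identity. -/
lemma exists_sublevel_eq_Icc {g : ℝ → ℝ} (hc : ContinuousOn g (Ici 0))
    (hm : MonotoneOn g (Ici 0)) (hg : ∀ x, 0 ≤ x → x ≤ g x) {x : ℝ} (hx : g 0 ≤ x) :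
    ∃ m, 0 ≤ m ∧ g m = x ∧ {ξ | 0 ≤ ξ ∧ g ξ ≤ x} = Icc 0 m := by
  have hx0 : 0 ≤ x := (hg 0 le_rfl).trans hx
  have hcx : ContinuousOn g (Icc 0 x) := hc.mono Icc_subset_Ici_self
  -- Since `ξ ≤ g ξ`, the sublevel set lies in `[0, x]`; this makes it compact.
  have hK : IsCompact (Icc 0 x ∩ g ⁻¹' Iic x) :=
    isCompact_Icc.of_isClosed_subset (hcx.preimage_isClosed_of_isClosed isClosed_Icc isClosed_Iic)
      inter_subset_left
  obtain ⟨m, ⟨⟨hm0, hmx⟩, hgm⟩, hmax⟩ := hK.exists_isGreatest ⟨0, ⟨le_rfl, hx0⟩, hx⟩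
  obtain ⟨c, ⟨hc1, hc2⟩, hgc⟩ := intermediate_value_Icc hmx
    (hcx.mono (Icc_subset_Icc_left hm0)) ⟨hgm, hg x hx0⟩
  have hcm : c = m := le_antisymm (hmax ⟨⟨hm0.trans hc1, hc2⟩, hgc.le⟩) hc1
  refine ⟨m, hm0, hcm ▸ hgc,
    Set.ext fun ξ => ⟨fun h => ⟨h.1, hmax ⟨⟨h.1, ?_⟩, h.2⟩⟩, fun h => ⟨h.1, ?_⟩⟩⟩
  · exact (hg ξ h.1).trans h.2
  · exact (hm h.1 hm0 h.2).trans hgm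

/-- Strict sublevel sets on `[0, ∞)` of a continuous monotone function that dominates the
identity. -/
lemma exists_strict_sublevel_eq_Ico {g : ℝ → ℝ} (hc : ContinuousOn g (Ici 0))
    (hm : MonotoneOn g (Ici 0)) (hg : ∀ x, 0 ≤ x → x ≤ g x) (x : ℝ) :
    ∃ m, 0 ≤ m ∧ x ≤ g m ∧ (0 < m → g m ≤ x) ∧ {ξ | 0 ≤ ξ ∧ g ξ < x} = Ico 0 m := by
  have hcl : IsClosed (Ici 0 ∩ g ⁻¹' Ici x) :=
    hc.preimage_isClosed_of_isClosed isClosed_Ici isClosed_Ici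
  have hne : (Ici 0 ∩ g ⁻¹' Ici x).Nonempty :=
    ⟨max x 0, mem_Ici.2 (le_max_right _ _), (le_max_left _ _).trans (hg _ (le_max_right _ _))⟩
  have hbd : BddBelow (Ici 0 ∩ g ⁻¹' Ici x) := ⟨0, fun y hy => hy.1⟩
  obtain ⟨hm0, hxm⟩ := hcl.csInf_mem hne hbd
  set m := sInf (Ici 0 ∩ g ⁻¹' Ici x)
  have hlow : ∀ ξ, 0 ≤ ξ → x ≤ g ξ → m ≤ ξ := fun ξ h1 h2 => csInf_le hbd ⟨h1, h2⟩
  refine ⟨m, hm0, hxm, fun hpos => ?_, Set.ext fun ξ => ⟨fun h => ⟨h.1, ?_⟩, fun h => ⟨h.1, ?_⟩⟩⟩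
  -- If `x < g 0`, the infimum is `0` and `g m` may exceed `x`; positivity of `m` excludes this.
  · have h0 : g 0 ≤ x := by
      by_contra! h
      exact absurd (hlow 0 le_rfl h.le) (not_le.2 hpos)
    obtain ⟨c, ⟨hc1, hc2⟩, hgc⟩ := intermediate_value_Icc hm0
      (hc.mono Icc_subset_Ici_self) ⟨h0, hxm⟩
    rw [le_antisymm (hlow c hc1 hgc.ge) hc2, hgc]
  · by_contra! hle
    exact absurd (hxm.trans (hm hm0 h.1 hle)) (not_le.2 h.2)
  · by_contra! hle
    exact absurd (hlow ξ h.1 hle) (not_le.2 h.2)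

namespace FlowOverTime

variable {V : Type*} {E : Type*} [Fintype E] {N : FlowNetwork V E}

/-! ### Queues and exit times of a single edge -/

section Edges

variable (f : N.FlowOverTime) (e : E)

/-- The growth rate of the queue. -/
noncomputable def queueRate (ξ : ℝ) : ℝ :=
  if 0 < f.queue e ξ then f.edgeInflow e ξ - N.capacity e
    else max (f.edgeInflow e ξ - N.capacity e) 0

/-- The amount of flow that has entered `e` up to time `θ`. -/
noncomputable def edgeVolume (θ : ℝ) : ℝ := ∫ ξ in (0 : ℝ)..θ, f.edgeInflow e ξ

variable {x y : ℝ}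

lemma intervalIntegrable_edgeInflow (hx : 0 ≤ x) (hy : 0 ≤ y) :
    IntervalIntegrable (f.edgeInflow e) volume x y :=
  (f.edgeInflow_integrable e x hx).symm.trans (f.edgeInflow_integrable e y hy)

lemma intervalIntegrable_edgeInflow_sub (hx : 0 ≤ x) (hy : 0 ≤ y) :
    IntervalIntegrable (fun ξ => f.edgeInflow e ξ - N.capacity e) volume x y :=
  (f.intervalIntegrable_edgeInflow e hx hy).sub intervalIntegrable_const

lemma intervalIntegrable_queueRate_zero (hx : 0 ≤ x) :
    IntervalIntegrable (f.queueRate e) volume 0 x := by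
  -- The queue is continuous only on `[0, ∞)`; precomposing with `max ξ 0` extends it without
  -- changing the relevant values.
  have hq : Continuous fun ξ : ℝ => f.queue e (max ξ 0) :=
    (f.queue_continuous e).comp_continuous (by fun_prop) fun ξ => le_max_right ξ 0
  have hs : MeasurableSet {ξ : ℝ | 0 < f.queue e (max ξ 0)} :=
    (isOpen_lt continuous_const hq).measurableSet
  have hi := (intervalIntegrable_iff_integrableOn_Ioc_of_le hx).1
    (f.intervalIntegrable_edgeInflow_sub e le_rfl hx)
  rw [intervalIntegrable_iff_integrableOn_Ioc_of_le hx]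
  refine IntegrableOn.congr_fun
    (Integrable.piecewise hs hi.integrableOn hi.pos_part.integrableOn) (fun ξ hξ => ?_)
    measurableSet_Ioc
  simp only [Set.piecewise, mem_ofPred_eq, max_eq_left hξ.1.le, queueRate]

lemma intervalIntegrable_queueRate (hx : 0 ≤ x) (hy : 0 ≤ y) :
    IntervalIntegrable (f.queueRate e) volume x y :=
  (f.intervalIntegrable_queueRate_zero e hx).symm.trans (f.intervalIntegrable_queueRate_zero e hy)

lemma queue_sub (hx : 0 ≤ x) (hy : 0 ≤ y) :
    f.queue e y - f.queue e x = ∫ ξ in x..y, f.queueRate e ξ := by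
  rw [f.queue_eq e y hy, f.queue_eq e x hx]
  exact intervalIntegral.integral_interval_sub_left
    (f.intervalIntegrable_queueRate_zero e hy) (f.intervalIntegrable_queueRate_zero e hx)

lemma queue_zero : f.queue e 0 = 0 := by
  rw [f.queue_eq e 0 le_rfl, intervalIntegral.integral_same]

lemma edgeVolume_sub (hx : 0 ≤ x) (hy : 0 ≤ y) :
    f.edgeVolume e y - f.edgeVolume e x = ∫ ξ in x..y, f.edgeInflow e ξ :=
  intervalIntegral.integral_interval_sub_left
    (f.edgeInflow_integrable e y hy) (f.edgeInflow_integrable e x hx)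

lemma integral_edgeInflow_sub (hx : 0 ≤ x) (hy : 0 ≤ y) :
    ∫ ξ in x..y, (f.edgeInflow e ξ - N.capacity e) =
      f.edgeVolume e y - f.edgeVolume e x - N.capacity e * (y - x) := by
  rw [intervalIntegral.integral_sub (f.intervalIntegrable_edgeInflow e hx hy)
    intervalIntegrable_const, f.edgeVolume_sub e hx hy, intervalIntegral.integral_const,
    smul_eq_mul, mul_comm]

lemma exists_last_queue_eq_nonneg (hx : 0 ≤ x) :
    ∃ y ∈ Icc 0 x, 0 ≤ f.queue e y ∧ ∀ ξ ∈ Ioc y x, f.queue e ξ < 0 := by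
  have hK : IsCompact (Icc 0 x ∩ f.queue e ⁻¹' Ici 0) :=
    isCompact_Icc.of_isClosed_subset
      (((f.queue_continuous e).mono Icc_subset_Ici_self).preimage_isClosed_of_isClosed
        isClosed_Icc isClosed_Ici) inter_subset_left
  obtain ⟨y, ⟨hy, hqy⟩, hmax⟩ := hK.exists_isGreatest
    ⟨0, ⟨le_rfl, hx⟩, (f.queue_zero e).ge⟩
  refine ⟨y, hy, hqy, fun ξ hξ => ?_⟩
  by_contra! h
  exact absurd (hmax ⟨⟨hy.1.trans hξ.1.le, hξ.2⟩, h⟩) (not_le.2 hξ.1)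

/-- After the last time with a nonnegative queue, the growth rate is a maximum with `0`, so the
queue cannot drop below `0`. -/
lemma queue_nonneg (hx : 0 ≤ x) : 0 ≤ f.queue e x := by
  obtain ⟨y, hy, hqy, hneg⟩ := f.exists_last_queue_eq_nonneg e hx
  have h : 0 ≤ ∫ ξ in y..x, f.queueRate e ξ := by
    rw [intervalIntegral.integral_of_le hy.2]
    refine setIntegral_nonneg measurableSet_Ioc fun ξ hξ => ?_
    rw [queueRate, if_neg (hneg ξ hξ).le.not_gt]
    exact le_max_right _ _
  rw [← f.queue_sub e hy.1 hx] at h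
  linarith

/-- The queue at time `x` consists of the flow that entered since the last time `y` at which it was
empty, minus the flow that left it at full capacity since then. -/
lemma exists_queue_eq (hx : 0 ≤ x) :
    ∃ y ∈ Icc 0 x, f.queue e x =
      f.edgeVolume e x - f.edgeVolume e y - N.capacity e * (x - y) := by
  have hK : IsCompact (Icc 0 x ∩ f.queue e ⁻¹' {0}) :=
    isCompact_Icc.of_isClosed_subset
      (((f.queue_continuous e).mono Icc_subset_Ici_self).preimage_isClosed_of_isClosed
        isClosed_Icc isClosed_singleton) inter_subset_left
  obtain ⟨y, ⟨hy, hqy⟩, hmax⟩ := hK.exists_isGreatest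
    ⟨0, ⟨le_rfl, hx⟩, f.queue_zero e⟩
  refine ⟨y, hy, ?_⟩
  rw [← f.integral_edgeInflow_sub e hy.1 hx, ← sub_zero (f.queue e x),
    ← (show f.queue e y = 0 from hqy), f.queue_sub e hy.1 hx,
    intervalIntegral.integral_of_le hy.2, intervalIntegral.integral_of_le hy.2]
  refine setIntegral_congr_fun measurableSet_Ioc fun ξ hξ => ?_
  have h0 : 0 ≤ ξ := hy.1.trans hξ.1.le
  refine if_pos ((f.queue_nonneg e h0).lt_of_ne fun h => ?_)
  exact absurd (hmax ⟨⟨h0, hξ.2⟩, h.symm⟩) (not_le.2 hξ.1)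

/-- An edge discharges at rate at most its capacity: the queue always grows at least at the rate
inflow minus capacity. Inflow being nonnegative, this also makes exit times monotone. -/
lemma edgeVolume_sub_le (hx : 0 ≤ x) (hxy : x ≤ y) :
    f.edgeVolume e y - f.edgeVolume e x ≤
      N.capacity e * (N.exitTime f.queue e y - N.exitTime f.queue e x) := by
  have hy := hx.trans hxy
  have h : ∫ ξ in x..y, (f.edgeInflow e ξ - N.capacity e) ≤ ∫ ξ in x..y, f.queueRate e ξ := by
    refine intervalIntegral.integral_mono_on hxy (f.intervalIntegrable_edgeInflow_sub e hx hy)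
      (f.intervalIntegrable_queueRate e hx hy) fun ξ _ => ?_
    rw [queueRate]
    split_ifs
    · exact le_rfl
    · exact le_max_left _ _
  rw [f.integral_edgeInflow_sub e hx hy, ← f.queue_sub e hx hy] at h
  have hc := (N.capacity_pos e).ne'
  have : N.capacity e * (N.exitTime f.queue e y - N.exitTime f.queue e x) =
      N.capacity e * (y - x) + (f.queue e y - f.queue e x) := by
    simp only [exitTime]
    field_simp
    ring
  linarith

lemma edgeVolume_mono (hx : 0 ≤ x) (hxy : x ≤ y) : f.edgeVolume e x ≤ f.edgeVolume e y := by
  rw [← sub_nonneg, f.edgeVolume_sub e hx (hx.trans hxy)]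
  exact intervalIntegral.integral_nonneg hxy fun ξ hξ => f.edgeInflow_nonneg e ξ (hx.trans hξ.1)

lemma edgeVolume_nonneg (hx : 0 ≤ x) : 0 ≤ f.edgeVolume e x := by
  simpa [edgeVolume] using f.edgeVolume_mono e le_rfl hx

lemma monotoneOn_exitTime : MonotoneOn (N.exitTime f.queue e) (Ici 0) := by
  intro x hx y _ hxy
  have h := (sub_nonneg.2 (f.edgeVolume_mono e hx hxy)).trans (f.edgeVolume_sub_le e hx hxy)
  exact sub_nonneg.1 (nonneg_of_mul_nonneg_right h (N.capacity_pos e))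

lemma continuousOn_exitTime : ContinuousOn (N.exitTime f.queue e) (Ici 0) := by
  have := f.queue_continuous e
  unfold exitTime
  fun_prop

lemma add_transit_le_exitTime (hx : 0 ≤ x) : x + N.transit e ≤ N.exitTime f.queue e x := by
  have := div_nonneg (f.queue_nonneg e hx) (N.capacity_pos e).le
  rw [exitTime]
  linarith

lemma exists_exitTime_eq (hx : 0 ≤ x) :
    ∃ y ∈ Icc 0 x, N.exitTime f.queue e x =
      N.transit e + y + (f.edgeVolume e x - f.edgeVolume e y) / N.capacity e := by
  obtain ⟨y, hy, h⟩ := f.exists_queue_eq e hx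
  refine ⟨y, hy, ?_⟩
  have hc := (N.capacity_pos e).ne'
  rw [exitTime, h]
  field_simp
  ring

end Edges

/-! ### Flow volumes and delays along a path -/

section Paths

variable (f : N.FlowOverTime) {θ θ' : ℝ}

lemma add_sum_transit_le_traversalTime (l : List E) (hθ : 0 ≤ θ) :
    θ + (l.map N.transit).sum ≤ N.traversalTime f.queue l θ := by
  induction l using List.reverseRecOn with
  | nil => simp
  | append_singleton l e ih =>
    have h0 : 0 ≤ (l.map N.transit).sum :=
      List.sum_nonneg (by simpa using fun a _ => N.transit_nonneg a)
    have := f.add_transit_le_exitTime e (hθ.trans ((le_add_of_nonneg_right h0).trans ih))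
    rw [traversalTime_concat, List.map_append, List.sum_append]
    simp only [List.map_cons, List.map_nil, List.sum_cons, List.sum_nil]
    linarith

lemma le_traversalTime (l : List E) (hθ : 0 ≤ θ) : θ ≤ N.traversalTime f.queue l θ :=
  (le_add_of_nonneg_right (List.sum_nonneg (by simpa using fun a _ => N.transit_nonneg a))).trans
    (f.add_sum_transit_le_traversalTime l hθ)

lemma traversalTime_nonneg (l : List E) (hθ : 0 ≤ θ) : 0 ≤ N.traversalTime f.queue l θ :=
  hθ.trans (f.le_traversalTime l hθ)

lemma monotoneOn_traversalTime (l : List E) :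
    MonotoneOn (N.traversalTime f.queue l) (Ici 0) := by
  induction l using List.reverseRecOn with
  | nil => exact monotoneOn_id
  | append_singleton l e ih =>
    intro x hx y hy hxy
    rw [traversalTime_concat, traversalTime_concat]
    exact f.monotoneOn_exitTime e (f.traversalTime_nonneg l hx) (f.traversalTime_nonneg l hy)
      (ih hx hy hxy)

lemma continuousOn_traversalTime (l : List E) :
    ContinuousOn (N.traversalTime f.queue l) (Ici 0) := by
  induction l using List.reverseRecOn with
  | nil => exact continuousOn_id
  | append_singleton l e ih =>
    exact ((f.continuousOn_exitTime e).comp ih fun x hx => f.traversalTime_nonneg l hx).congr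
      fun x _ => traversalTime_concat f.queue l e x

/-- The amount of flow that has started on `P` up to time `θ`. -/
noncomputable def pathVolume (P : N.Path) (θ : ℝ) : ℝ := ∫ ξ in (0 : ℝ)..θ, f.pathInflow P ξ

variable (P : N.Path)

lemma pathInflow_le (hθ : 0 ≤ θ) : f.pathInflow P θ ≤ N.u := by
  rw [← f.sum_pathInflow θ hθ]
  exact Finset.single_le_sum (f := fun Q => f.pathInflow Q θ)
    (fun Q _ => f.pathInflow_nonneg Q θ hθ) (Finset.mem_univ P)

lemma intervalIntegrable_pathInflow_zero (hθ : 0 ≤ θ) :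
    IntervalIntegrable (f.pathInflow P) volume 0 θ := by
  refine (intervalIntegrable_const (c := N.u)).mono_fun
    (f.pathInflow_measurable P).aestronglyMeasurable ?_
  refine (ae_restrict_mem measurableSet_uIoc).mono fun ξ hξ => ?_
  rw [uIoc_of_le hθ] at hξ
  beta_reduce
  rw [Real.norm_of_nonneg (f.pathInflow_nonneg P ξ hξ.1.le), Real.norm_of_nonneg N.u_pos.le]
  exact f.pathInflow_le P hξ.1.le

lemma pathVolume_sub (hθ : 0 ≤ θ) (hθ' : 0 ≤ θ') :
    f.pathVolume P θ' - f.pathVolume P θ = ∫ ξ in θ..θ', f.pathInflow P ξ :=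
  intervalIntegral.integral_interval_sub_left
    (f.intervalIntegrable_pathInflow_zero P hθ') (f.intervalIntegrable_pathInflow_zero P hθ)

lemma pathVolume_mono (hθ : 0 ≤ θ) (h : θ ≤ θ') : f.pathVolume P θ ≤ f.pathVolume P θ' := by
  rw [← sub_nonneg, f.pathVolume_sub P hθ (hθ.trans h)]
  exact intervalIntegral.integral_nonneg h fun ξ hξ => f.pathInflow_nonneg P ξ (hθ.trans hξ.1)

lemma pathVolume_zero : f.pathVolume P 0 = 0 := intervalIntegral.integral_same

lemma pathVolume_nonneg (hθ : 0 ≤ θ) : 0 ≤ f.pathVolume P θ := by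
  simpa [pathVolume_zero] using f.pathVolume_mono P le_rfl hθ

lemma sum_pathVolume (hθ : 0 ≤ θ) : ∑ P, f.pathVolume P θ = N.u * θ := by
  simp only [pathVolume]
  rw [← intervalIntegral.integral_finsetSum
      fun P _ => f.intervalIntegrable_pathInflow_zero P hθ,
    intervalIntegral.integral_congr (g := fun _ => N.u)
      fun ξ hξ => f.sum_pathInflow ξ (by rw [uIcc_of_le hθ] at hξ; exact hξ.1)]
  simp [mul_comm]

variable {P} {l₁ l₂ : List E} {e : E}

/-- By edge disjointness only `P` uses `e`, so the sum over the paths has a single term. -/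
lemma edgeVolume_eq (hN : N.IsParallelPath) (h : P.edges = l₁ ++ e :: l₂) (hθ : 0 ≤ θ) :
    f.edgeVolume e θ =
      ∫ ξ in {ξ : ℝ | 0 ≤ ξ ∧ N.traversalTime f.queue l₁ ξ ≤ θ}, f.pathInflow P ξ := by
  have he : e ∈ P.edges := by simp [h]
  rw [edgeVolume, f.edgeInflow_eq e θ hθ, Finset.sum_eq_single P, if_pos he]
  · simp only [arrivalTime_src f.queue P h]
  · exact fun Q _ hQ => if_neg fun heQ => hN Q P hQ heQ he
  · simp

lemma exists_edgeVolume_eq_pathVolume (hN : N.IsParallelPath) (h : P.edges = l₁ ++ e :: l₂)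
    {x : ℝ} (hx : N.traversalTime f.queue l₁ 0 ≤ x) :
    ∃ ξ, 0 ≤ ξ ∧ N.traversalTime f.queue l₁ ξ = x ∧ f.edgeVolume e x = f.pathVolume P ξ ∧
      ∀ ξ', 0 ≤ ξ' → N.traversalTime f.queue l₁ ξ' ≤ x → ξ' ≤ ξ := by
  obtain ⟨m, hm, hmx, hset⟩ := exists_sublevel_eq_Icc (f.continuousOn_traversalTime l₁)
    (f.monotoneOn_traversalTime l₁) (fun _ => f.le_traversalTime l₁) hx
  refine ⟨m, hm, hmx, ?_, fun ξ' h0 h1 => ?_⟩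
  · rw [f.edgeVolume_eq hN h ((f.traversalTime_nonneg l₁ le_rfl).trans hx), hset, pathVolume,
      integral_Icc_eq_integral_Ioc, intervalIntegral.integral_of_le hm]
  · have : ξ' ∈ {ξ | 0 ≤ ξ ∧ N.traversalTime f.queue l₁ ξ ≤ x} := ⟨h0, h1⟩
    rw [hset] at this
    exact this.2

/-- First in, first out: when particle `θ` enters an edge of `P`, the flow that has entered this
edge is the flow that has started on `P` up to time `θ`. -/
lemma edgeVolume_traversalTime (hN : N.IsParallelPath) (h : P.edges = l₁ ++ e :: l₂)
    (hθ : 0 ≤ θ) : f.edgeVolume e (N.traversalTime f.queue l₁ θ) = f.pathVolume P θ := by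
  induction l₁ using List.reverseRecOn generalizing e l₂ θ with
  | nil =>
    obtain ⟨ξ, -, hξ, hvol, -⟩ := f.exists_edgeVolume_eq_pathVolume hN h
      (f.monotoneOn_traversalTime [] self_mem_Ici hθ hθ)
    rw [hvol]
    exact congrArg _ hξ
  | append_singleton l a ih =>
    obtain ⟨ξ, hξ0, hξ, hvol, hmax⟩ := f.exists_edgeVolume_eq_pathVolume hN h
      (f.monotoneOn_traversalTime _ self_mem_Ici hθ hθ)
    have hle := hmax θ hθ le_rfl
    have hs : P.edges = l ++ a :: (e :: l₂) := by simpa using h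
    -- Particle `ξ` is the last to reach `e` together with `θ`. Both leave `a` at the same time, so
    -- by the capacity bound no flow entered `a` between them.
    have hb := f.edgeVolume_sub_le a (f.traversalTime_nonneg l hθ)
      (f.monotoneOn_traversalTime l hθ hξ0 hle)
    rw [ih hs hθ, ih hs hξ0, ← traversalTime_concat, ← traversalTime_concat, hξ, sub_self,
      mul_zero] at hb
    rw [hvol]
    exact le_antisymm (by linarith) (f.pathVolume_mono P hθ hle)

/-- The flow started between `θ` and `θ'` leaves `e` within a time window: its start is bounded
below by the transit times up to and including `e`, its end above by the sink time less the transit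
times after `e`. -/
lemma pathVolume_sub_le (hN : N.IsParallelPath) (he : e ∈ P.edges) (hθ : 0 ≤ θ) (h : θ ≤ θ') :
    f.pathVolume P θ' - f.pathVolume P θ ≤
      N.capacity e * (f.sinkTime P θ' - (P.edges.map N.transit).sum - θ) := by
  obtain ⟨l₁, l₂, hs⟩ := List.append_of_mem he
  have hθ' := hθ.trans h
  have hb := f.edgeVolume_sub_le e (f.traversalTime_nonneg l₁ hθ)
    (f.monotoneOn_traversalTime l₁ hθ hθ' h)
  rw [f.edgeVolume_traversalTime hN hs hθ, f.edgeVolume_traversalTime hN hs hθ',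
    ← traversalTime_concat, ← traversalTime_concat] at hb
  refine hb.trans (mul_le_mul_of_nonneg_left ?_ (N.capacity_pos e).le)
  have h₁ := f.add_sum_transit_le_traversalTime (l₁ ++ [e]) hθ
  have h₂ := f.add_sum_transit_le_traversalTime l₂ (f.traversalTime_nonneg (l₁ ++ [e]) hθ')
  rw [← traversalTime_append] at h₂
  rw [sinkTime, arrivalTime_sink, hs]
  simp only [List.append_assoc, List.singleton_append, List.map_append, List.map_cons,
    List.map_nil, List.sum_append, List.sum_cons, List.sum_nil] at h₁ h₂ ⊢
  linarith

/-- Delays at successive edges do not add up beyond one queue at the bottleneck rate. At the last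
edge, go back to the time `y` when its queue was last empty: the delay up to `y` is bounded by
induction through the flow started by then, and the remaining delay by the flow started since. -/
lemma traversalTime_le (hN : N.IsParallelPath) {ν : ℝ} (hν : 0 < ν)
    (hP : ∀ a ∈ P.edges, ν ≤ N.capacity a) (h : P.edges = l₁ ++ l₂) (hθ : 0 ≤ θ) :
    N.traversalTime f.queue l₁ θ ≤ (l₁.map N.transit).sum + θ + f.pathVolume P θ / ν := by
  induction l₁ using List.reverseRecOn generalizing l₂ θ with
  | nil =>
    have := div_nonneg (f.pathVolume_nonneg P hθ) hν.le
    simpa using this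
  | append_singleton l e ih =>
    have hs : P.edges = l ++ e :: l₂ := by simpa using h
    have hcap := hP e (by simp [hs])
    obtain ⟨y, hy, hT⟩ := f.exists_exitTime_eq e (f.traversalTime_nonneg l hθ)
    rw [f.edgeVolume_traversalTime hN hs hθ] at hT
    rw [traversalTime_concat, hT, List.map_append, List.sum_append]
    simp only [List.map_cons, List.map_nil, List.sum_cons, List.sum_nil]
    rcases le_total (N.traversalTime f.queue l 0) y with h0 | h0
    · obtain ⟨ξ, hξ0, hξ, hvol, -⟩ := f.exists_edgeVolume_eq_pathVolume hN hs h0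
      have hle : f.pathVolume P ξ ≤ f.pathVolume P θ := by
        rw [← hvol, ← f.edgeVolume_traversalTime hN hs hθ]
        exact f.edgeVolume_mono e hy.1 hy.2
      -- As the last particle to reach `e` at time `y`, `ξ` may start after `θ`; then no flow starts
      -- between them, and induction is applied to `θ` itself.
      have hξθ : ξ ≤ θ ∨ f.pathVolume P ξ = f.pathVolume P θ := by
        rcases le_total ξ θ with h1 | h1
        · exact Or.inl h1
        · exact Or.inr (le_antisymm hle (f.pathVolume_mono P hθ h1))
      have hmono := div_le_div_of_nonneg_left (sub_nonneg.2 hle) hν hcap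
      rcases hξθ with h1 | h1
      · have := ih hs hξ0
        rw [hξ] at this
        rw [hvol]
        rw [sub_div _ _ ν] at hmono
        linarith
      · have := ih hs hθ
        rw [hvol, h1, sub_self, zero_div]
        linarith [hy.2]
    -- Here `y` is no later than the arrival of particle `0`, which meets no delay before `e`.
    · have h1 := ih hs le_rfl
      rw [f.pathVolume_zero, zero_div] at h1
      have h2 : (f.pathVolume P θ - f.edgeVolume e y) / N.capacity e ≤ f.pathVolume P θ / ν :=
        div_le_div₀ (f.pathVolume_nonneg P hθ) (by linarith [f.edgeVolume_nonneg e hy.1]) hν hcap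
      linarith

lemma mul_sub_le_pathVolume (hN : N.IsParallelPath) {ν : ℝ} (hν : 0 < ν)
    (hP : ∀ a ∈ P.edges, ν ≤ N.capacity a) (hθ : 0 ≤ θ) :
    ν * (f.sinkTime P θ - (P.edges.map N.transit).sum - θ) ≤ f.pathVolume P θ := by
  have h := f.traversalTime_le hN hν hP (List.append_nil P.edges).symm hθ
  rw [← arrivalTime_sink, ← sinkTime] at h
  rw [← le_div_iff₀' hν]
  linarith

end Paths

/-! ### Comparing a Nash flow with an arbitrary flow -/

section Throughput

variable (f g : N.FlowOverTime)

/-- The particles that reach the sink before the deadline along `P` are those of an interval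
`[0, m)`, and the throughput of `P` is the flow that has started on `P` up to time `m`. -/
lemma exists_last_departure (P : N.Path) :
    ∃ m, 0 ≤ m ∧ N.D ≤ f.sinkTime P m ∧ (0 < m → f.sinkTime P m ≤ N.D) ∧
      (∀ θ, 0 ≤ θ → (f.sinkTime P θ < N.D ↔ θ < m)) ∧
      ∫ θ in {θ : ℝ | 0 ≤ θ ∧ f.sinkTime P θ < N.D}, f.pathInflow P θ = f.pathVolume P m := by
  have hsink : f.sinkTime P = N.traversalTime f.queue P.edges :=
    funext fun θ => arrivalTime_sink f.queue P θ
  obtain ⟨m, hm, h₁, h₂, hset⟩ := exists_strict_sublevel_eq_Ico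
    (f.continuousOn_traversalTime P.edges) (f.monotoneOn_traversalTime P.edges)
    (fun _ => f.le_traversalTime P.edges) N.D
  rw [hsink]
  refine ⟨m, hm, h₁, h₂, fun θ hθ => ?_, ?_⟩
  · have := Set.ext_iff.1 hset θ
    simpa [hθ] using this
  · rw [hset, pathVolume, integral_Ico_eq_integral_Ioc, intervalIntegral.integral_of_le hm]

variable {f} in
/-- In a Nash flow, no flow starts on a path that misses the deadline while some other path is
still in time. -/
lemma IsNash.pathInflow_eq_zero (hf : f.IsNash) {P Q : N.Path} {θ : ℝ} (hθ : 0 ≤ θ)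
    (hP : N.D ≤ f.sinkTime P θ) (hQ : f.sinkTime Q θ < N.D) : f.pathInflow P θ = 0 := by
  by_contra h
  have hle := hf θ hθ P ((f.pathInflow_nonneg P θ hθ).lt_of_ne' h) Q
  rw [particleCost, particleCost, if_neg hP.not_gt, if_pos hQ, top_le_iff] at hle
  exact EReal.coe_ne_top _ hle

variable {f} in
theorem IsNash.throughput_le_two_mul (hN : N.IsParallelPath) (hf : f.IsNash) :
    g.throughput ≤ 2 * f.throughput := by
  choose m hm0 hmD _ hmlt hmvol using f.exists_last_departure
  choose n hn0 _ hnD _ hnvol using g.exists_last_departure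
  -- Some path exists because the positive inflow `u` has to be carried.
  have hne : (Finset.univ : Finset N.Path).Nonempty := by
    rw [Finset.nonempty_iff_ne_empty]
    intro h
    have := f.sum_pathInflow 0 le_rfl
    rw [h, Finset.sum_empty] at this
    exact N.u_pos.ne this
  obtain ⟨Q, -, hQ⟩ := Finset.exists_max_image Finset.univ m hne
  have hMf : f.throughput = ∑ P, f.pathVolume P (m P) := Finset.sum_congr rfl fun P _ => hmvol P
  have hMg : g.throughput = ∑ P, g.pathVolume P (n P) := Finset.sum_congr rfl fun P _ => hnvol P
  have hvol : ∀ P, f.pathVolume P (m P) = f.pathVolume P (m Q) := by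
    intro P
    have hPQ := hQ P (Finset.mem_univ P)
    rw [eq_comm, ← sub_eq_zero, f.pathVolume_sub P (hm0 P) (hm0 Q),
      intervalIntegral.integral_of_le hPQ, ← integral_Ico_eq_integral_Ioc,
      setIntegral_congr_fun (g := fun _ => 0) measurableSet_Ico, integral_zero]
    intro θ hθ
    have h0 := (hm0 P).trans hθ.1
    exact hf.pathInflow_eq_zero h0 (not_lt.1 fun h => ((hmlt P θ h0).1 h).not_ge hθ.1)
      ((hmlt Q θ h0).2 hθ.2)
  have hMfu : f.throughput = N.u * m Q := by
    rw [hMf, Finset.sum_congr rfl fun P _ => hvol P, f.sum_pathVolume (hm0 Q)]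
  -- The departures of `g` on `P` are split at time `m Q`; the later ones are charged to the flow of
  -- `f` on the same path.
  have hbound : ∀ P, g.pathVolume P (n P) ≤ g.pathVolume P (m Q) + f.pathVolume P (m P) := by
    intro P
    have hF := f.pathVolume_nonneg P (hm0 P)
    rcases le_total (n P) (m Q) with h | h
    · linarith [g.pathVolume_mono P (hn0 P) h]
    rcases h.eq_or_lt with h | h
    · rw [h]
      linarith
    obtain ⟨e, he, hmin⟩ := exists_bottleneck P
    have hg := g.pathVolume_sub_le hN he (hm0 Q) h.le
    have hl := f.mul_sub_le_pathVolume hN (N.capacity_pos e) hmin (hm0 P)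
    have hc := (N.capacity_pos e).le
    -- In `g` particle `n P` arrives by `D`, in `f` particle `m P` not before `D`, and `m P ≤ m Q`.
    have := mul_le_mul_of_nonneg_left (show
      g.sinkTime P (n P) - (P.edges.map N.transit).sum - m Q ≤
        f.sinkTime P (m P) - (P.edges.map N.transit).sum - m P by
      linarith [hnD P ((hm0 Q).trans_lt h), hmD P, hQ P (Finset.mem_univ P)]) hc
    linarith
  calc g.throughput ≤ ∑ P, (g.pathVolume P (m Q) + f.pathVolume P (m P)) :=
        hMg ▸ Finset.sum_le_sum fun P _ => hbound P
    _ = 2 * f.throughput := by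
        rw [Finset.sum_add_distrib, g.sum_pathVolume (hm0 Q), ← hMf, ← hMfu, two_mul]

end Throughput

end FlowOverTime

theorem throughputPoA_le_two {V E : Type*} [Fintype E] {N : FlowNetwork V E}
    (hN : N.IsParallelPath) : N.throughputPoA ≤ 2 := by
  -- This form of division also covers zero throughput: then the bound forces the numerator to be
  -- `0`, and `0 / 0 = 0`.
  refine iSup₂_le fun f hf => ENNReal.div_le_of_le_mul (iSup_le fun g => ?_)
  rw [← ENNReal.ofReal_ofNat 2, ← ENNReal.ofReal_mul zero_le_two]
  exact ENNReal.ofReal_le_ofReal (hf.throughput_le_two_mul g hN)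

/-! ### Tightness: two parallel links -/

section TwoLink

variable {ε : ℝ} {h0 : 0 < ε} {h1 : ε < 1}

lemma twoLink_edges_eq (P : (twoLink ε h0 h1).Path) : ∃ e, P.edges = [e] := by
  obtain ⟨p, hp, -⟩ := P
  match p, hp with
  | [], hp => exact absurd hp (by simp [IsWalk, twoLink])
  | [e], _ => exact ⟨e, rfl⟩
  | e :: a :: _, hp => exact absurd hp.2.1 (by simp [twoLink])

/-- The path of the two-link network that consists of the link `e`. -/
def twoLinkPath (h0 : 0 < ε) (h1 : ε < 1) (e : Fin 2) : (twoLink ε h0 h1).Path :=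
  ⟨[e], ⟨rfl, rfl⟩, by simp [twoLink]⟩

@[simp]
lemma edges_twoLinkPath (e : Fin 2) : (twoLinkPath h0 h1 e).edges = [e] := rfl

lemma twoLinkPath_bijective : Function.Bijective (twoLinkPath h0 h1) := by
  refine ⟨fun a b h => ?_, fun P => ?_⟩
  · have := congrArg Path.edges h
    simpa using this
  · obtain ⟨e, he⟩ := twoLink_edges_eq P
    exact ⟨e, Subtype.ext he.symm⟩

lemma sum_twoLink_path (F : (twoLink ε h0 h1).Path → ℝ) :
    ∑ P, F P = F (twoLinkPath h0 h1 0) + F (twoLinkPath h0 h1 1) := by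
  rw [← twoLinkPath_bijective.sum_comp, Fin.sum_univ_two]

lemma isParallelPath_twoLink : (twoLink ε h0 h1).IsParallelPath := by
  intro P Q hPQ
  obtain ⟨a, ha⟩ := twoLink_edges_eq P
  obtain ⟨b, hb⟩ := twoLink_edges_eq Q
  rw [ha, hb, List.disjoint_singleton, List.mem_singleton]
  rintro rfl
  exact hPQ (Subtype.ext (ha.trans hb.symm))

lemma arrivalTime_twoLink_src (z : Fin 2 → ℝ → ℝ) (P : (twoLink ε h0 h1).Path) (e : Fin 2)
    (θ : ℝ) : (twoLink ε h0 h1).arrivalTime z P ((twoLink ε h0 h1).src e) θ = θ := by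
  obtain ⟨a, ha⟩ := twoLink_edges_eq P
  exact arrivalTime_src z P (l₁ := []) (e := a) ha θ

lemma arrivalTime_twoLink_sink (z : Fin 2 → ℝ → ℝ) (e : Fin 2) (θ : ℝ) :
    (twoLink ε h0 h1).arrivalTime z (twoLinkPath h0 h1 e) (twoLink ε h0 h1).t θ =
      (twoLink ε h0 h1).exitTime z e θ :=
  arrivalTime_sink z _ θ

/-- The flow over time in the two-link network that sends flow into the cheaper link at the
constant rate `a ≥ ε` and into the more expensive one at the rate `1 - a`. -/
noncomputable def twoLinkFlow (h0 : 0 < ε) (h1 : ε < 1) (a : ℝ) (ha : ε ≤ a) (ha1 : a ≤ 1) :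
    (twoLink ε h0 h1).FlowOverTime where
  pathInflow P _ := (P.edges.map ![a, 1 - a]).sum
  edgeInflow e _ := ![a, 1 - a] e
  -- The expensive link never queues, since `1 - a ≤ 1 - ε`.
  queue e θ := ![a - ε, 0] e * θ
  pathInflow_measurable _ := measurable_const
  pathInflow_nonneg P _ _ := by
    refine List.sum_nonneg fun x hx => ?_
    obtain ⟨e, -, rfl⟩ := List.mem_map.1 hx
    fin_cases e
    · simpa using h0.le.trans ha
    · simpa using ha1
  edgeInflow_nonneg e _ _ := by
    fin_cases e
    · simpa using h0.le.trans ha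
    · simpa using ha1
  edgeInflow_integrable _ _ _ := intervalIntegrable_const
  sum_pathInflow _ _ := by
    rw [sum_twoLink_path]
    simp only [edges_twoLinkPath]
    simp [twoLink]
  queue_continuous _ := by fun_prop
  queue_eq e θ hθ := by
    rw [intervalIntegral.integral_congr (g := fun _ => ![a - ε, 0] e)]
    · simp [mul_comm]
    · intro ξ _
      fin_cases e
      · have : 0 ≤ a - ε := sub_nonneg.2 ha
        simp [twoLink, this]
      · simp [twoLink, ha]
  edgeInflow_eq e θ hθ := by
    rw [sum_twoLink_path]
    simp only [arrivalTime_twoLink_src, edges_twoLinkPath, List.mem_singleton]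
    have hset : {ξ : ℝ | 0 ≤ ξ ∧ ξ ≤ θ} = Icc 0 θ := rfl
    fin_cases e
    · simp [hset, hθ]
    · simp [hset, hθ, mul_sub]
  conservation v hv := by
    refine Filter.Eventually.of_forall fun θ _ => ?_
    have hv0 : v = 0 := by
      fin_cases v
      · rfl
      · exact absurd rfl hv
    subst hv0
    simp [twoLink]

variable {a : ℝ} {ha : ε ≤ a} {ha1 : a ≤ 1}

lemma sinkTime_twoLinkFlow_cheap (θ : ℝ) :
    (twoLinkFlow h0 h1 a ha ha1).sinkTime (twoLinkPath h0 h1 0) θ = a * θ / ε := by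
  rw [FlowOverTime.sinkTime, arrivalTime_twoLink_sink]
  simp only [exitTime, twoLinkFlow, twoLink, Matrix.cons_val_zero]
  field_simp
  ring

lemma sinkTime_twoLinkFlow_expensive (θ : ℝ) :
    (twoLinkFlow h0 h1 a ha ha1).sinkTime (twoLinkPath h0 h1 1) θ = θ + (1 - ε) := by
  rw [FlowOverTime.sinkTime, arrivalTime_twoLink_sink]
  simp [exitTime, twoLinkFlow, twoLink]

/-- The cheap link is saturated and delivers `ε` for every `a`; the other delivers rate `1 - a` for
the departures in `[0, ε)`. -/
lemma throughput_twoLinkFlow :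
    (twoLinkFlow h0 h1 a ha ha1).throughput = ε + ε * (1 - a) := by
  have ha0 := h0.trans_le ha
  have hset0 : {θ : ℝ | 0 ≤ θ ∧ a * θ / ε < 1} = Ico 0 (ε / a) := by
    ext θ
    rw [mem_ofPred_eq, mem_Ico, div_lt_one h0, lt_div_iff₀' ha0]
  have hset1 : {θ : ℝ | 0 ≤ θ ∧ θ + (1 - ε) < 1} = Ico 0 ε := by
    ext θ
    rw [mem_ofPred_eq, mem_Ico]
    refine and_congr_right fun _ => ⟨fun h => by linarith, fun h => by linarith⟩
  rw [FlowOverTime.throughput, sum_twoLink_path]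
  simp only [sinkTime_twoLinkFlow_cheap, sinkTime_twoLinkFlow_expensive]
  rw [show (twoLink ε h0 h1).D = 1 from rfl, hset0, hset1]
  have : 0 ≤ ε / a := div_nonneg h0.le ha0.le
  simp [twoLinkFlow, this, h0.le]
  field_simp

lemma isNash_twoLinkFlow_one : (twoLinkFlow h0 h1 1 h1.le le_rfl).IsNash := by
  intro θ hθ P hP Q
  obtain ⟨i, rfl⟩ := twoLinkPath_bijective.surjective P
  obtain ⟨j, rfl⟩ := twoLinkPath_bijective.surjective Q
  have hi : i = 0 := by
    fin_cases i
    · rfl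
    · simp [twoLinkFlow] at hP
  subst hi
  rcases Fin.exists_fin_two.1 ⟨j, rfl⟩ with rfl | rfl
  · exact le_rfl
  -- Both links are in time exactly for `θ < ε`, so the expensive one never offers an advantage.
  · have hiff : 1 * θ / ε < 1 ↔ θ + (1 - ε) < 1 := by
      rw [one_mul, div_lt_one h0]
      exact ⟨fun h => by linarith, fun h => by linarith⟩
    simp only [FlowOverTime.particleCost, sinkTime_twoLinkFlow_cheap,
      sinkTime_twoLinkFlow_expensive]
    rw [show (twoLink ε h0 h1).D = 1 from rfl]
    simp only [hiff]
    split_ifs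
    · rw [EReal.coe_le_coe_iff]
      simp only [pathCost, edges_twoLinkPath]
      simp [twoLink]
    · exact le_rfl

/-- The Nash flow `a = 1` delivers `ε`, while `a = ε` delivers `ε * (2 - ε)`. -/
theorem le_throughputPoA_twoLink :
    ENNReal.ofReal (2 - ε) ≤ (twoLink ε h0 h1).throughputPoA := by
  refine le_trans ?_ (le_iSup₂ (twoLinkFlow h0 h1 1 h1.le le_rfl) isNash_twoLinkFlow_one)
  have hN : (twoLinkFlow h0 h1 1 h1.le le_rfl).throughput = ε := by
    simp [throughput_twoLinkFlow]
  rw [hN, ENNReal.le_div_iff_mul_le (Or.inl (by simpa using h0)) (Or.inl ENNReal.ofReal_ne_top),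
    ← ENNReal.ofReal_mul (by linarith)]
  refine le_trans (ENNReal.ofReal_le_ofReal ?_)
    (le_iSup (fun f : (twoLink ε h0 h1).FlowOverTime => ENNReal.ofReal f.throughput)
      (twoLinkFlow h0 h1 ε le_rfl h1.le))
  rw [throughput_twoLinkFlow]
  linarith

end TwoLink

end FlowNetwork

theorem mainTheorem1 :
    (∀ (V : Type*) (E : Type*) [Fintype E] (N : FlowNetwork V E),
      N.IsParallelPath → N.throughputPoA ≤ 2) ∧
    (∀ (ε : ℝ) (h0 : 0 < ε) (h1 : ε < 1),
      (FlowNetwork.twoLink ε h0 h1).IsParallelPath ∧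
      ENNReal.ofReal (2 - ε) ≤ (FlowNetwork.twoLink ε h0 h1).throughputPoA) :=
  ⟨fun _ _ _ _ hN => FlowNetwork.throughputPoA_le_two hN,
    fun _ _ _ => ⟨FlowNetwork.isParallelPath_twoLink, FlowNetwork.le_throughputPoA_twoLink⟩⟩
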